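/- Let $\mathcal A=\{a,b\}$. For a finite word $w$ let $w^{(+)}$ be the shortest palindrome having $w$ as a prefix, and define the palindromization map by $\psi(\varepsilon)=\varepsilon$ and $\psi(vx)=(\psi(v)x)^{(+)}$ for $v\in\mathcal A^*$, $x\in\mathcal A$; for an infinite word $x=x_1x_2\cdots$ put $\psi(x)=\lim_{n\to\infty}\psi(x_1\cdots x_n)$. A central word of order $n$ is a word $\psi(v)$ with $|v|=n$. A characteristic Sturmian word is the limit of a sequence of words $s_{-1}=b$, $s_0=a$, $s_n=s_{n-1}^{c_n}s_{n-2}$ $(n\ge 1)$, where $c_1\ge 0$ and $c_n>0$ for $n>1$ are integers. Theorem. Let $s$ be an infinite word over $\mathcal A$. The following are equivalent: 1. $s$ is a characteristic Sturmian word beginning with the letter $a$, and for every $n\ge 0$ each palindromic prefix of $s$ that is a central word of order $n$ has at least as many occurrences of the letter $b$ as every central word of order $n$ beginning with $a$; 2. $s$ is the Fibonacci word $f=\psi((ab)^\omega)$ or the word $g=\psi(ab^2(ab)^\omega)$. -/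

import Mathlib

open Filter

namespace CharSturm

/-- The binary alphabet. -/
inductive Letter : Type
  | a : Letter
  | b : Letter
  deriving DecidableEq

/-- Finite words; the empty word is `[]`. -/
abbrev Word : Type := List Letter

/-- Right-infinite words; the first letter has index `0`. -/
abbrev InfWord : Type := Stream' Letter

/-- The finite word `w` is a prefix of the infinite word `x`. -/
def IsPrefixOf (w : Word) (x : InfWord) : Prop := x.take w.length = w

/-- A sequence of finite words converges to an infinite word: each letter of the infinite word is
eventually the letter at the same position of the finite words. -/
def ConvergesTo (w : ℕ → Word) (x : InfWord) : Prop :=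
  ∀ k : ℕ, ∀ᶠ n in atTop, (w n)[k]? = some (x.get k)

/-- Right palindromic closure `u Q ↦ u Q uᴿ`, with `Q` the longest palindromic suffix: letters are
moved to `u` until what remains is a palindrome. -/
def palClosure : Word → Word
  | [] => []
  | x :: w => if (x :: w).Palindrome then x :: w else x :: (palClosure w ++ [x])

theorem palClosure_palindrome (w : Word) : (palClosure w).Palindrome := by
  induction w with
  | nil => exact List.Palindrome.nil
  | cons x w ih =>
    rw [palClosure]
    split_ifs with h
    · exact h
    · exact List.Palindrome.cons_concat x ih

theorem prefix_palClosure (w : Word) : w <+: palClosure w := by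
  induction w with
  | nil => exact List.prefix_rfl
  | cons x w ih =>
    rw [palClosure]
    split_ifs with h
    · exact List.prefix_rfl
    · exact (List.prefix_cons_inj x).2 (ih.trans (List.prefix_append _ _))

/-- `palClosure w` is the shortest palindrome having `w` as a prefix: any palindrome with prefix `w`
is longer or equal to it. -/
theorem palClosure_shortest (w p : Word) (hp : p.Palindrome) (hw : w <+: p) :
    (palClosure w).length < p.length ∨ palClosure w = p := by
  induction w generalizing p with
  | nil =>
    cases p with
    | nil => right; rfl
    | cons y p => left; simp [palClosure]
  | cons x w ih =>
    rw [palClosure]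
    split_ifs with h
    · rcases hw.length_le.lt_or_eq with hl | hl
      · exact Or.inl hl
      · exact Or.inr (hw.eq_of_length hl)
    · cases hp with
      | nil => simp at hw
      | singleton y =>
        obtain ⟨rfl, hw'⟩ := List.cons_prefix_cons.1 hw
        rw [List.prefix_nil] at hw'
        subst hw'
        exact absurd (List.Palindrome.singleton x) h
      | @cons_concat y l hl =>
        obtain ⟨rfl, hw'⟩ := List.cons_prefix_cons.1 hw
        rcases List.prefix_concat_iff.1 hw' with heq | hpre
        · subst heq
          exact absurd (List.Palindrome.cons_concat x hl) h
        · rcases ih l hl hpre with h1 | h1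
          · left; simpa using h1
          · right; rw [h1]

/-- The palindromization map: `ψ(ε) = ε` and `ψ(v x)` is the right palindromic closure of
`ψ(v) x`. -/
def psi (v : Word) : Word := v.foldl (fun w x => palClosure (w ++ [x])) []

theorem psi_nil : psi [] = [] := rfl

theorem psi_concat (v : Word) (x : Letter) : psi (v ++ [x]) = palClosure (psi v ++ [x]) := by
  simp [psi]

theorem psi_concat_prefix (v : Word) (x : Letter) : psi v ++ [x] <+: psi (v ++ [x]) := by
  rw [psi_concat]; exact prefix_palClosure _

theorem length_le_length_psi (v : Word) : v.length ≤ (psi v).length := by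
  induction v using List.reverseRecOn with
  | nil => simp
  | append_singleton v x ih =>
    have h := (psi_concat_prefix v x).length_le
    simp only [List.length_append, List.length_singleton] at h ⊢
    omega

/-- The palindromization map on infinite words: since `ψ` of the prefix of length `k + 1` has at
least `k + 1` letters, its letter at position `k` exists and is the letter of the limit. -/
def psiInf (x : InfWord) : InfWord := fun k =>
  (psi (x.take (k + 1)))[k]'(by
    have h := length_le_length_psi (x.take (k + 1))
    rw [Stream'.length_take] at h
    exact h)

theorem psi_take_prefix (x : InfWord) {m n : ℕ} (h : m ≤ n) :
    psi (x.take m) <+: psi (x.take n) := by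
  induction n, h using Nat.le_induction with
  | base => exact List.prefix_rfl
  | succ n _ ih =>
    rw [Stream'.take_succ']
    exact ih.trans ((List.prefix_append _ _).trans (psi_concat_prefix _ _))

/-- `ψ(x)` is the limit of the images under `ψ` of the prefixes of `x`. -/
theorem psiInf_convergesTo (x : InfWord) : ConvergesTo (fun n => psi (x.take n)) (psiInf x) := by
  intro k
  filter_upwards [eventually_ge_atTop (k + 1)] with n hn
  have hk : k < (psi (x.take (k + 1))).length := by
    have h := length_le_length_psi (x.take (k + 1))
    rw [Stream'.length_take] at h
    exact h
  have hpre := psi_take_prefix x hn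
  rw [List.getElem?_eq_getElem (hk.trans_le hpre.length_le)]
  congr 1
  exact (hpre.getElem hk).symm

/-- The sequence of standard words `s₋₁ = b`, `s₀ = a`, `sₙ = sₙ₋₁ ^ cₙ sₙ₋₂` for `n ≥ 1`. Indices are
shifted: `stdWord c n` is `sₙ₋₁` and `c n` is `cₙ₊₁`. -/
def stdWord (c : ℕ → ℕ) : ℕ → Word
  | 0 => [Letter.b]
  | 1 => [Letter.a]
  | n + 2 => (List.replicate (c n) (stdWord c (n + 1))).flatten ++ stdWord c n

/-- Characteristic (standard) Sturmian words: the limits of the sequences of standard words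
`s₋₁ = b`, `s₀ = a`, `sₙ = sₙ₋₁ ^ cₙ sₙ₋₂` with `c₁ ≥ 0` and `cₙ > 0` for `n > 1`. -/
def IsCharSturmian (s : InfWord) : Prop :=
  ∃ c : ℕ → ℕ, (∀ n, 1 ≤ n → 0 < c n) ∧ ConvergesTo (stdWord c) s

/-- `w` is a central word of order `n`: its directive word has length `n`. -/
def IsCentralOfOrder (n : ℕ) (w : Word) : Prop := ∃ v : Word, v.length = n ∧ psi v = w

/-- `w` is a palindromic prefix of order `n` of the infinite word `s`. -/
def IsPalPrefixOfOrder (s : InfWord) (n : ℕ) (w : Word) : Prop :=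
  w.Palindrome ∧ IsPrefixOf w s ∧ IsCentralOfOrder n w

/-- The palindromic prefixes of any order of `s` have the maximal number of occurrences of `b`,
the maximum being taken over the central words of the same order which begin with `a`. (The only
central word of order `0` is the empty word.) -/
def HasMaxB (s : InfWord) : Prop :=
  ∀ (n : ℕ) (w : Word), IsPalPrefixOfOrder s n w →
    ∀ w' : Word, IsCentralOfOrder n w' → [Letter.a] <+: w' →
      w'.count Letter.b ≤ w.count Letter.b

/-- The infinite word `(ab)^ω`. -/
def abOmega : InfWord := Stream'.cycle [Letter.a, Letter.b] (by simp)

/-- The Fibonacci word `ψ((ab)^ω)`. -/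
def fibWord : InfWord := psiInf abOmega

/-- The word `ψ(ab²(ab)^ω)`. -/
def gWord : InfWord := psiInf ([Letter.a, Letter.b, Letter.b] ++ₛ abOmega)

end CharSturm

namespace CharSturm

/-! ### Prefixes of infinite words -/

/-! A characteristic Sturmian word is `psiInf x` with `x` the directive word a^{c₁} b^{c₂} a^{c₃} ⋯
(`IsCharSturmian.exists_psiInf`), and its palindromic prefix of order n is `psi` of the length-n
prefix of `x` (`isPrefixOf_psi_iff`). Justin's formula ψ(vz) = μ_v(z) ψ(v) (`psi_concat_eq_muWord`)
turns the problem into arithmetic: with p, q the numbers of b in μ_v(a), μ_v(b), the number of b in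
ψ(v) is p + q - 1, and appending a or b to v replaces (p, q) by (p, p + q) or (p + q, q).

A directive word beginning with a starts from (0, 1), so p + q is at most a Fibonacci number
(`count_muWord_le_fib`). Equality at every length forces the second letter to be b, giving (1, 1).
The third letter is then free by symmetry, and afterwards the larger entry must be the one added,
that is, the letters alternate (`isAlternating_of_count`). The free third letter accounts for the
two words. -/

theorem isPrefixOf_iff {w : Word} {x : InfWord} :
    IsPrefixOf w x ↔ ∀ k < w.length, w[k]? = some (x.get k) := by
  unfold IsPrefixOf
  constructor
  · intro h k hk
    rw [← h, Stream'.getElem?_take hk]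
  · intro h
    apply List.ext_getElem?
    intro k
    by_cases hk : k < w.length
    · rw [Stream'.getElem?_take hk, h k hk]
    · rw [List.getElem?_eq_none (by simpa using hk), List.getElem?_eq_none (by simpa using hk)]

theorem IsPrefixOf.of_prefix {w w' : Word} {x : InfWord} (h : IsPrefixOf w x) (hw : w' <+: w) :
    IsPrefixOf w' x := by
  rw [isPrefixOf_iff] at h ⊢
  intro k hk
  have hk' := hk.trans_le hw.length_le
  rw [← h k hk', List.getElem?_eq_getElem hk, List.getElem?_eq_getElem hk', hw.getElem hk]

theorem IsPrefixOf.get_eq {w : Word} {z : Letter} {x : InfWord} (h : IsPrefixOf (w ++ [z]) x) :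
    z = x.get w.length := by
  have := isPrefixOf_iff.1 h w.length (by simp)
  simpa using this

theorem isPrefixOf_append_singleton {w : Word} {z : Letter} {x : InfWord} :
    IsPrefixOf (w ++ [z]) x ↔ IsPrefixOf w x ∧ z = x.get w.length := by
  refine ⟨fun h => ⟨h.of_prefix (List.prefix_append _ _), h.get_eq⟩, fun ⟨h, hz⟩ => ?_⟩
  unfold IsPrefixOf at *
  rw [List.length_append, List.length_singleton, Stream'.take_succ', h, hz]

theorem convergesTo_unique {w : ℕ → Word} {x y : InfWord} (hx : ConvergesTo w x)
    (hy : ConvergesTo w y) : x = y := by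
  apply Stream'.ext
  intro k
  obtain ⟨n, h1, h2⟩ := ((hx k).and (hy k)).exists
  exact Option.some_injective _ (h1.symm.trans h2)

theorem convergesTo_of_isPrefixOf {w : ℕ → Word} {x : InfWord}
    (h : ∀ᶠ n in atTop, IsPrefixOf (w n) x)
    (hl : Tendsto (fun n => (w n).length) atTop atTop) : ConvergesTo w x := by
  intro k
  filter_upwards [h, hl.eventually_gt_atTop k] with n h1 h2
  exact isPrefixOf_iff.1 h1 k h2

theorem exists_isPrefixOf {w : ℕ → Word} (h : ∀ n, w n <+: w (n + 1))
    (hl : ∀ k, ∃ n, k < (w n).length) : ∃ x : InfWord, ∀ n, IsPrefixOf (w n) x := by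
  have hmono : ∀ m n, m ≤ n → w m <+: w n := by
    intro m n hmn
    induction n, hmn using Nat.le_induction with
    | base => exact List.prefix_rfl
    | succ n _ ih => exact ih.trans (h n)
  choose N hN using hl
  refine ⟨fun k => (w (N k))[k]'(hN k), fun n => isPrefixOf_iff.2 fun k hk => ?_⟩
  rw [List.getElem?_eq_getElem hk]
  congr 1
  rcases le_total n (N k) with h1 | h1
  · exact (hmono _ _ h1).getElem hk
  · exact ((hmono _ _ h1).getElem (hN k)).symm

/-! ### The elementary morphisms and Justin's formula -/

/-- The morphism fixing `x` and sending the other letter `y` to `x y`. -/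
def mu (x : Letter) (w : Word) : Word := w.flatMap fun y => if y = x then [x] else [x, y]

@[simp] theorem mu_nil (x : Letter) : mu x [] = [] := rfl

theorem mu_cons (x y : Letter) (w : Word) :
    mu x (y :: w) = (if y = x then [x] else [x, y]) ++ mu x w := rfl

@[simp] theorem mu_cons_self (x : Letter) (w : Word) : mu x (x :: w) = x :: mu x w := by
  simp [mu_cons]

theorem mu_cons_of_ne {x y : Letter} (h : y ≠ x) (w : Word) :
    mu x (y :: w) = x :: y :: mu x w := by
  simp [mu_cons, h]

@[simp] theorem mu_append (x : Letter) (u w : Word) : mu x (u ++ w) = mu x u ++ mu x w := by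
  simp [mu]

theorem mu_injective (x : Letter) : Function.Injective (mu x) := by
  intro u w h
  induction u generalizing w with
  | nil =>
    cases w with
    | nil => rfl
    | cons y w => rw [mu_cons] at h; split_ifs at h <;> simp at h
  | cons z u ih =>
    cases w with
    | nil => rw [mu_cons] at h; split_ifs at h <;> simp at h
    | cons y w =>
      -- A nonempty image begins with `x`, so the letter after a leading `x` tells whether that `x`
      -- is a whole block.
      have head_of : ∀ {t t' : Word} {c : Letter}, c ≠ x → mu x t = c :: t' → False := by
        intro t t' c hc ht
        cases t with
        | nil => simp at ht
        | cons d t =>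
          rw [mu_cons] at ht
          split_ifs at ht <;> simp at ht <;> exact hc ht.1.symm
      by_cases hz : z = x <;> by_cases hy : y = x
      · subst hz; subst hy
        rw [mu_cons_self, mu_cons_self, List.cons.injEq] at h
        rw [ih h.2]
      · subst hz
        rw [mu_cons_self, mu_cons_of_ne hy, List.cons.injEq] at h
        exact (head_of hy h.2).elim
      · subst hy
        rw [mu_cons_self, mu_cons_of_ne hz, List.cons.injEq] at h
        exact (head_of hz h.2.symm).elim
      · rw [mu_cons_of_ne hz, mu_cons_of_ne hy] at h
        simp only [List.cons.injEq, true_and] at h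
        rw [h.1, ih h.2]

theorem reverse_mu_concat (x : Letter) (w : Word) :
    (mu x w ++ [x]).reverse = mu x w.reverse ++ [x] := by
  induction w with
  | nil => rfl
  | cons y w ih =>
    by_cases h : y = x
    · subst h
      rw [mu_cons_self, List.cons_append, List.reverse_cons, ih, List.reverse_cons, mu_append]
      simp
    · rw [mu_cons_of_ne h, List.cons_append, List.cons_append, List.reverse_cons,
        List.reverse_cons, ih, List.reverse_cons, mu_append, mu_cons_of_ne h]
      simp

theorem palindrome_mu_concat {x : Letter} {w : Word} :
    (mu x w ++ [x]).Palindrome ↔ w.Palindrome := by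
  rw [List.Palindrome.iff_reverse_eq, List.Palindrome.iff_reverse_eq, reverse_mu_concat,
    List.append_cancel_right_eq, (mu_injective x).eq_iff]

theorem not_palindrome_of_ne {x y : Letter} (h : x ≠ y) (w : Word) :
    ¬ (x :: (w ++ [y])).Palindrome := by
  rw [List.Palindrome.iff_reverse_eq]
  intro h'
  simp at h'
  exact h h'.1.symm

theorem palindrome_cons_concat_iff {x : Letter} {w : Word} :
    (x :: (w ++ [x])).Palindrome ↔ w.Palindrome := by
  rw [List.Palindrome.iff_reverse_eq, List.Palindrome.iff_reverse_eq]
  simp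

theorem palClosure_cons_of_not {x : Letter} {w : Word} (h : ¬ (x :: w).Palindrome) :
    palClosure (x :: w) = x :: (palClosure w ++ [x]) := by
  rw [palClosure, if_neg h]

theorem palClosure_of_palindrome {w : Word} (h : w.Palindrome) : palClosure w = w := by
  cases w with
  | nil => rfl
  | cons x w => rw [palClosure, if_pos h]

/-- The map w ↦ μ_x(w) x preserves and reflects palindromes, so the closure strips whole blocks of
μ_x(w) in step with the letters of w; inside a block xy it cannot stop, since what remains begins
with y and ends with x. -/
theorem palClosure_mu_concat_self (x : Letter) (w : Word) :
    palClosure (mu x w ++ [x]) = mu x (palClosure w) ++ [x] := by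
  induction w with
  | nil => simp [palClosure_of_palindrome (List.Palindrome.singleton x), palClosure]
  | cons y w ih =>
    by_cases hp : (y :: w).Palindrome
    · rw [palClosure_of_palindrome hp, palClosure_of_palindrome (palindrome_mu_concat.2 hp)]
    have hp' := mt (palindrome_mu_concat (x := x)).1 hp
    rw [palClosure_cons_of_not hp]
    by_cases h : y = x
    · subst h
      rw [mu_cons_self, List.cons_append] at hp' ⊢
      rw [palClosure_cons_of_not hp', ih]
      simp
    · rw [mu_cons_of_ne h, List.cons_append, List.cons_append] at hp' ⊢
      rw [palClosure_cons_of_not hp', palClosure_cons_of_not (not_palindrome_of_ne h _), ih]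
      simp [mu_cons_of_ne h]

theorem palClosure_mu_concat_of_ne {x y : Letter} (h : y ≠ x) (w : Word) :
    palClosure (mu x w ++ [x] ++ [y]) = mu x (palClosure (w ++ [y])) ++ [x] := by
  induction w with
  | nil =>
    rw [mu_nil, List.nil_append, List.nil_append,
      palClosure_of_palindrome (List.Palindrome.singleton y), mu_cons_of_ne h]
    change palClosure [x, y] = _
    have hn : ¬ [x, y].Palindrome := not_palindrome_of_ne h.symm []
    rw [palClosure_cons_of_not hn, palClosure_of_palindrome (List.Palindrome.singleton y)]
    simp
  | cons z w ih =>
    by_cases hz : z = x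
    · subst hz
      rw [mu_cons_self, List.cons_append, List.cons_append, List.cons_append,
        palClosure_cons_of_not (not_palindrome_of_ne h.symm _),
        palClosure_cons_of_not (not_palindrome_of_ne h.symm _), ih]
      simp
    · have hzy : z = y := by
        cases x <;> cases y <;> cases z <;> simp_all
      subst hzy
      rw [mu_cons_of_ne h, List.cons_append, List.cons_append, List.cons_append, List.cons_append,
        palClosure_cons_of_not (w := z :: (mu x w ++ [x] ++ [z]))
          (not_palindrome_of_ne h.symm (z :: (mu x w ++ [x]))),
        List.cons_append]
      by_cases hp : w.Palindrome
      · rw [palClosure_of_palindrome (palindrome_cons_concat_iff.2 (palindrome_mu_concat.2 hp)),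
          palClosure_of_palindrome (palindrome_cons_concat_iff.2 hp)]
        simp [mu_cons_of_ne h]
      · rw [palClosure_cons_of_not
            (mt palindrome_cons_concat_iff.1 (mt palindrome_mu_concat.1 hp)),
          palClosure_cons_of_not (mt palindrome_cons_concat_iff.1 hp), ih]
        simp [mu_cons_of_ne h]

/-- Palindromic closure commutes with w ↦ μ_x(w) x, whichever letter is appended before closing.
This is Justin's formula for a letter added on the left. -/
theorem psi_cons (x : Letter) (v : Word) : psi (x :: v) = mu x (psi v) ++ [x] := by
  induction v using List.reverseRecOn with
  | nil => exact palClosure_of_palindrome (List.Palindrome.singleton x)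
  | append_singleton v y ih =>
    rw [← List.cons_append, psi_concat, ih, psi_concat]
    by_cases h : y = x
    · subst h
      rw [← palClosure_mu_concat_self, mu_append]
      simp
    · exact palClosure_mu_concat_of_ne h _

/-- The composition of the elementary morphisms along a directive word. -/
def muWord (v : Word) (w : Word) : Word := v.foldr mu w

theorem muWord_append_right (v u w : Word) : muWord v (u ++ w) = muWord v u ++ muWord v w := by
  induction v with
  | nil => rfl
  | cons x v ih => simpa [muWord] using congrArg (mu x) ih

theorem muWord_append_left (u v w : Word) : muWord (u ++ v) w = muWord u (muWord v w) := by
  simp [muWord]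

/-- Justin's formula for one letter. -/
theorem psi_concat_eq_muWord (v : Word) (z : Letter) :
    psi (v ++ [z]) = muWord v [z] ++ psi v := by
  induction v with
  | nil => exact palClosure_of_palindrome (List.Palindrome.singleton z)
  | cons x v ih =>
    rw [List.cons_append, psi_cons, ih, psi_cons, mu_append, List.append_assoc]
    rfl

theorem muWord_concat_self (v : Word) (x : Letter) : muWord (v ++ [x]) [x] = muWord v [x] := by
  rw [muWord_append_left]
  simp [muWord]

theorem muWord_concat_of_ne (v : Word) {x y : Letter} (h : y ≠ x) :
    muWord (v ++ [x]) [y] = muWord v [x] ++ muWord v [y] := by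
  rw [muWord_append_left, ← muWord_append_right]
  simp [muWord, mu_cons_of_ne h]

theorem muWord_append_replicate_self (v : Word) (n : ℕ) (x : Letter) :
    muWord (v ++ List.replicate n x) [x] = muWord v [x] := by
  induction n with
  | zero => simp
  | succ n ih => rw [List.replicate_succ', ← List.append_assoc, muWord_concat_self, ih]

theorem muWord_append_replicate_of_ne (v : Word) (n : ℕ) {x y : Letter} (h : y ≠ x) :
    muWord (v ++ List.replicate n x) [y] =
      (List.replicate n (muWord v [x])).flatten ++ muWord v [y] := by
  induction n with
  | zero => simp
  | succ n ih =>
    rw [List.replicate_succ', ← List.append_assoc, muWord_concat_of_ne _ h, ih,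
      muWord_append_replicate_self, List.replicate_succ, List.flatten_cons, List.append_assoc]

/-! ### Palindromic prefixes of `ψ(x)` -/

theorem isPrefixOf_psiInf_take (x : InfWord) (n : ℕ) : IsPrefixOf (psi (x.take n)) (psiInf x) := by
  rw [isPrefixOf_iff]
  intro k hk
  obtain ⟨m, h1, h2⟩ := ((psiInf_convergesTo x k).and (eventually_ge_atTop n)).exists
  rw [← h1]
  have hp := psi_take_prefix x h2
  rw [List.getElem?_eq_getElem hk, List.getElem?_eq_getElem (hk.trans_le hp.length_le),
    hp.getElem hk]

theorem IsPrefixOf.psi {v : Word} {x : InfWord} (h : IsPrefixOf v x) :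
    IsPrefixOf (psi v) (psiInf x) := by
  have := isPrefixOf_psiInf_take x v.length
  rwa [h] at this

/-- The directive word can be read off: the letter following ψ(v) in ψ(x) is the letter of x
following v. -/
theorem isPrefixOf_psi_iff {v : Word} {x : InfWord} :
    IsPrefixOf (psi v) (psiInf x) ↔ IsPrefixOf v x := by
  refine ⟨fun h => ?_, IsPrefixOf.psi⟩
  induction v using List.reverseRecOn with
  | nil => rfl
  | append_singleton v z ih =>
    have h1 := h.of_prefix (psi_concat_prefix v z)
    have hv := ih (h1.of_prefix (List.prefix_append _ _))
    have h2 : IsPrefixOf (v ++ [x.get v.length]) x := isPrefixOf_append_singleton.2 ⟨hv, rfl⟩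
    have h3 := h2.psi.of_prefix (psi_concat_prefix v _)
    rw [h1.get_eq.trans h3.get_eq.symm]
    exact h2

theorem psi_palindrome (v : Word) : (psi v).Palindrome := by
  induction v using List.reverseRecOn with
  | nil => exact List.Palindrome.nil
  | append_singleton v z _ => rw [psi_concat]; exact palClosure_palindrome _

theorem head_psiInf (x : InfWord) : (psiInf x).head = x.head := by
  have h : IsPrefixOf ([] ++ [x.head]) x := isPrefixOf_append_singleton.2 ⟨rfl, rfl⟩
  exact (h.psi.of_prefix (psi_concat_prefix [] _)).get_eq.symm

theorem head_of_prefix_psi {v : Word} {z : Letter} (h : [z] <+: psi v) : ∃ u, v = z :: u := by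
  cases v with
  | nil => simp [psi_nil] at h
  | cons y u =>
    have hy : [y] <+: psi (y :: u) := by
      rw [psi_cons]
      cases psi u with
      | nil => exact List.prefix_rfl
      | cons t p => rw [mu_cons]; split_ifs <;> simp
    have := (List.prefix_of_prefix_length_le h hy le_rfl).eq_of_length rfl
    simp at this
    exact ⟨u, by rw [this]⟩

/-! ### Standard words -/

/-- The letter of the `n`-th block of a directive word `a^{c₁} b^{c₂} a^{c₃} ⋯`. -/
def blockLetter : ℕ → Letter
  | 0 => Letter.a
  | 1 => Letter.b
  | n + 2 => blockLetter n

theorem blockLetter_succ_ne (n : ℕ) : blockLetter (n + 1) ≠ blockLetter n := by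
  induction n with
  | zero => simp [blockLetter]
  | succ n ih => exact ih.symm

/-- The first `n` blocks of the directive word `a^{c₁} b^{c₂} a^{c₃} ⋯`. -/
def blockWord (c : ℕ → ℕ) : ℕ → Word
  | 0 => []
  | n + 1 => blockWord c n ++ List.replicate (c n) (blockLetter n)

/-- A block of equal letters fixes the image of its own letter and puts that many copies of it
before the image of the other letter. This is the recursion for standard words, the two letters
exchanging roles at each block. -/
theorem stdWord_eq_muWord (c : ℕ → ℕ) (n : ℕ) :
    stdWord c (n + 1) = muWord (blockWord c n) [blockLetter n] ∧
      stdWord c n = muWord (blockWord c n) [blockLetter (n + 1)] := by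
  induction n with
  | zero => exact ⟨rfl, rfl⟩
  | succ n ih =>
    refine ⟨?_, ?_⟩
    · rw [stdWord, blockWord, muWord_append_replicate_of_ne _ _ (blockLetter_succ_ne n),
        ← ih.1, ← ih.2]
    · change _ = muWord _ [blockLetter n]
      rw [blockWord, muWord_append_replicate_self, ih.1]

theorem length_stdWord_pos (c : ℕ → ℕ) (n : ℕ) : 0 < (stdWord c n).length := by
  induction n using Nat.twoStepInduction with
  | zero => simp [stdWord]
  | one => simp [stdWord]
  | more n ih _ => rw [stdWord, List.length_append]; omega

theorem length_stdWord_ge {c : ℕ → ℕ} (hc : ∀ n, 1 ≤ n → 0 < c n) (n : ℕ) :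
    n ≤ (stdWord c (n + 2)).length := by
  induction n with
  | zero => simp
  | succ n ih =>
    rw [stdWord, List.length_append]
    have h1 := length_stdWord_pos c (n + 1)
    change n ≤ (stdWord c (n + 1 + 1)).length at ih
    obtain ⟨m, hm⟩ := Nat.exists_eq_add_one.2 (hc (n + 1) (by omega))
    rw [hm, List.replicate_succ, List.flatten_cons, List.length_append]
    omega

theorem length_blockWord_ge {c : ℕ → ℕ} (hc : ∀ n, 1 ≤ n → 0 < c n) (n : ℕ) :
    n ≤ (blockWord c (n + 1)).length := by
  induction n with
  | zero => simp
  | succ n ih =>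
    rw [blockWord, List.length_append, List.length_replicate]
    have := hc (n + 1) (by omega)
    omega

theorem convergesTo_stdWord {c : ℕ → ℕ} (hc : ∀ n, 1 ≤ n → 0 < c n) {x : InfWord}
    (hx : ∀ᶠ n in atTop, IsPrefixOf (blockWord c n) x) : ConvergesTo (stdWord c) (psiInf x) := by
  apply convergesTo_of_isPrefixOf
  · obtain ⟨N, hN⟩ := eventually_atTop.1 hx
    -- The shift makes the block index n at least 1, so `c n` is positive and the block supplies the
    -- letter needed in `h2`; `c 0` may vanish.
    filter_upwards [eventually_ge_atTop (N + 2)] with n' hn'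
    obtain ⟨n, rfl⟩ := Nat.exists_eq_add_of_le' (show 1 ≤ n' by omega)
    have h1 := hN (n + 1) (by omega)
    obtain ⟨m, hm⟩ := Nat.exists_eq_add_one.2 (hc n (by omega))
    have h2 : blockWord c n ++ [blockLetter n] <+: blockWord c (n + 1) := by
      rw [blockWord, hm, List.replicate_succ, List.append_cons _ _ (List.replicate _ _)]
      exact List.prefix_append _ _
    rw [(stdWord_eq_muWord c n).1]
    apply (h1.of_prefix h2).psi.of_prefix
    rw [psi_concat_eq_muWord]
    exact List.prefix_append _ _
  · refine tendsto_atTop_atTop.2 fun b => ⟨b + 2, fun n hn => ?_⟩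
    obtain ⟨m, rfl⟩ := Nat.exists_eq_add_of_le' (show 2 ≤ n by omega)
    have := length_stdWord_ge hc m
    omega

theorem IsCharSturmian.exists_psiInf {s : InfWord} (hs : IsCharSturmian s) :
    ∃ x, s = psiInf x := by
  obtain ⟨c, hc, h⟩ := hs
  obtain ⟨x, hx⟩ := exists_isPrefixOf (w := blockWord c) (fun n => List.prefix_append _ _)
    fun k => ⟨k + 2, length_blockWord_ge hc (k + 1)⟩
  exact ⟨x, convergesTo_unique h (convergesTo_stdWord hc (Eventually.of_forall hx))⟩

/-! ### Counting occurrences of `b` -/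

theorem count_psi_add_one (v : Word) :
    (psi v).count Letter.b + 1 =
      (muWord v [Letter.a]).count Letter.b + (muWord v [Letter.b]).count Letter.b := by
  induction v using List.reverseRecOn with
  | nil => rfl
  | append_singleton v z ih =>
    rw [psi_concat_eq_muWord, List.count_append, add_assoc, ih]
    cases z
    · rw [muWord_concat_self, muWord_concat_of_ne v (y := Letter.b) (by decide), List.count_append]
    · rw [muWord_concat_self, muWord_concat_of_ne v (y := Letter.a) (by decide), List.count_append]
      ring

theorem count_muWord_concat_a (v : Word) :
    (muWord (v ++ [Letter.a]) [Letter.a]).count Letter.b = (muWord v [Letter.a]).count Letter.b ∧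
    (muWord (v ++ [Letter.a]) [Letter.b]).count Letter.b =
      (muWord v [Letter.a]).count Letter.b + (muWord v [Letter.b]).count Letter.b := by
  rw [muWord_concat_self, muWord_concat_of_ne v (y := Letter.b) (by decide), List.count_append]
  exact ⟨rfl, rfl⟩

theorem count_muWord_concat_b (v : Word) :
    (muWord (v ++ [Letter.b]) [Letter.b]).count Letter.b = (muWord v [Letter.b]).count Letter.b ∧
    (muWord (v ++ [Letter.b]) [Letter.a]).count Letter.b =
      (muWord v [Letter.b]).count Letter.b + (muWord v [Letter.a]).count Letter.b := by
  rw [muWord_concat_self, muWord_concat_of_ne v (y := Letter.a) (by decide), List.count_append]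
  exact ⟨rfl, rfl⟩

/-- The three bounds are proved together: a step keeps one entry and replaces the other by the old
sum, so the new sum is the old sum plus one old entry. -/
theorem count_muWord_le_fib (v : Word) :
    (muWord (Letter.a :: v) [Letter.a]).count Letter.b ≤ Nat.fib (v.length + 1) ∧
    (muWord (Letter.a :: v) [Letter.b]).count Letter.b ≤ Nat.fib (v.length + 1) ∧
    (muWord (Letter.a :: v) [Letter.a]).count Letter.b +
      (muWord (Letter.a :: v) [Letter.b]).count Letter.b ≤ Nat.fib (v.length + 2) := by
  induction v using List.reverseRecOn with
  | nil => decide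
  | append_singleton v z ih =>
    rw [← List.cons_append, List.length_append, List.length_singleton]
    have hf : Nat.fib (v.length + 1 + 2) = Nat.fib (v.length + 1) + Nat.fib (v.length + 2) :=
      Nat.fib_add_two
    have hle : Nat.fib (v.length + 1) ≤ Nat.fib (v.length + 2) := Nat.fib_le_fib_succ
    obtain ⟨h1, h2, h3⟩ := ih
    cases z
    · obtain ⟨e1, e2⟩ := count_muWord_concat_a (Letter.a :: v)
      rw [e1, e2, hf]
      change _ ≤ Nat.fib (v.length + 2) ∧ _ ≤ Nat.fib (v.length + 2) ∧ _
      refine ⟨?_, ?_, ?_⟩ <;> omega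
    · obtain ⟨e1, e2⟩ := count_muWord_concat_b (Letter.a :: v)
      rw [e1, e2, hf]
      change _ ≤ Nat.fib (v.length + 2) ∧ _ ≤ Nat.fib (v.length + 2) ∧ _
      refine ⟨?_, ?_, ?_⟩ <;> omega

theorem count_psi_le_fib (v : Word) :
    (psi (Letter.a :: v)).count Letter.b + 1 ≤ Nat.fib (v.length + 2) := by
  rw [count_psi_add_one]
  exact (count_muWord_le_fib v).2.2

/-- A directive word beginning with `ab` in which the letters alternate from the third one on. -/
structure IsAlternating (x : InfWord) : Prop where
  get_zero : x.get 0 = Letter.a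
  get_one : x.get 1 = Letter.b
  get_succ_ne : ∀ k, 2 ≤ k → x.get (k + 1) ≠ x.get k

/-- Along alternating letters the two counts are consecutive Fibonacci numbers, the smaller
belonging to the last letter. Alternation is assumed only below `N` so that the strong induction in
`isAlternating_of_count` can use this. -/
theorem count_muWord_take {x : InfWord} {N : ℕ} (h0 : x.get 0 = Letter.a)
    (h1 : x.get 1 = Letter.b) (hx : ∀ k, 2 ≤ k → k < N → x.get (k + 1) ≠ x.get k)
    {k : ℕ} (hk : 2 ≤ k) (hkN : k ≤ N) :
    (x.get k = Letter.a ∧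
      (muWord (x.take (k + 1)) [Letter.a]).count Letter.b = Nat.fib k ∧
      (muWord (x.take (k + 1)) [Letter.b]).count Letter.b = Nat.fib (k + 1)) ∨
    (x.get k = Letter.b ∧
      (muWord (x.take (k + 1)) [Letter.a]).count Letter.b = Nat.fib (k + 1) ∧
      (muWord (x.take (k + 1)) [Letter.b]).count Letter.b = Nat.fib k) := by
  induction k, hk using Nat.le_induction with
  | base =>
    have ht : x.take 3 = [Letter.a, Letter.b, x.get 2] := by
      rw [Stream'.take_succ', Stream'.take_succ', Stream'.take_succ', h0, h1]; rfl
    rw [ht]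
    cases x.get 2
    · left; decide
    · right; decide
  | succ k hk ih =>
    rw [Stream'.take_succ']
    have hne := hx k hk (by omega)
    have hf : Nat.fib (k + 1 + 1) = _ := Nat.fib_add_two
    rw [hf]
    rcases ih (by omega) with ⟨e, e1, e2⟩ | ⟨e, e1, e2⟩
    · have e' : x.get (k + 1) = Letter.b := by
        rw [e] at hne
        cases h : x.get (k + 1) <;> simp_all
      right
      obtain ⟨g1, g2⟩ := count_muWord_concat_b (x.take (k + 1))
      rw [e', g1, g2, e1, e2]
      exact ⟨rfl, by ring, rfl⟩
    · have e' : x.get (k + 1) = Letter.a := by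
        rw [e] at hne
        cases h : x.get (k + 1) <;> simp_all
      left
      obtain ⟨g1, g2⟩ := count_muWord_concat_a (x.take (k + 1))
      rw [e', g1, g2, e1, e2]
      exact ⟨rfl, rfl, by ring⟩

theorem IsAlternating.count_psi_take {x : InfWord} (hx : IsAlternating x) (k : ℕ) :
    (psi (x.take (k + 1))).count Letter.b + 1 = Nat.fib (k + 2) := by
  rw [count_psi_add_one]
  match k with
  | 0 =>
    have ht : x.take 1 = [Letter.a] := by rw [Stream'.take_succ', hx.get_zero]; rfl
    rw [ht]; decide
  | 1 =>
    have ht : x.take 2 = [Letter.a, Letter.b] := by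
      rw [Stream'.take_succ', Stream'.take_succ', hx.get_zero, hx.get_one]; rfl
    rw [ht]; decide
  | k + 2 =>
    rw [Nat.fib_add_two]
    rcases count_muWord_take (N := k + 2) hx.get_zero hx.get_one
      (fun j hj _ => hx.get_succ_ne j hj) (Nat.le_add_left 2 k) le_rfl with
      ⟨_, e1, e2⟩ | ⟨_, e1, e2⟩ <;> rw [e1, e2]
    ring

theorem take_succ_eq_cons {x : InfWord} (h : x.get 0 = Letter.a) (k : ℕ) :
    x.take (k + 1) = Letter.a :: x.tail.take k := by
  rw [Stream'.take_succ, ← h]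

theorem isAlternating_of_count {x : InfWord} (h0 : x.get 0 = Letter.a)
    (hx : ∀ k, (psi (x.take (k + 1))).count Letter.b + 1 = Nat.fib (k + 2)) :
    IsAlternating x := by
  have h1 : x.get 1 = Letter.b := by
    have h := hx 1
    have ht : x.take 2 = [Letter.a, x.get 1] := by
      rw [Stream'.take_succ', Stream'.take_succ', h0]; rfl
    rw [count_psi_add_one, ht] at h
    cases h' : x.get 1
    · rw [h'] at h; revert h; decide
    · rfl
  refine ⟨h0, h1, fun k => ?_⟩
  induction k using Nat.strong_induction_on with
  | _ k ih =>
    intro hk heq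
    have h := hx (k + 1)
    have hpos : 0 < Nat.fib k := Nat.fib_pos.2 (by omega)
    -- A repeated letter makes the sum fall short by exactly this difference; strictness needs `2 ≤
    -- k`, and the tie `fib 1 = fib 2` is what leaves the third letter free.
    have hlt : Nat.fib k < Nat.fib (k + 1) := Nat.fib_lt_fib_succ hk
    have hf : Nat.fib (k + 1 + 2) = _ := Nat.fib_add_two
    have hf' : Nat.fib (k + 1 + 1) = _ := Nat.fib_add_two
    rw [count_psi_add_one, Stream'.take_succ', heq, hf, hf'] at h
    rcases count_muWord_take (N := k) h0 h1 (fun j hj hjk => ih j hjk hj) hk le_rfl with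
      ⟨e, e1, e2⟩ | ⟨e, e1, e2⟩
    · obtain ⟨g1, g2⟩ := count_muWord_concat_a (x.take (k + 1))
      rw [e, g1, g2, e1, e2] at h
      omega
    · obtain ⟨g1, g2⟩ := count_muWord_concat_b (x.take (k + 1))
      rw [e, g1, g2, e1, e2] at h
      omega

theorem IsAlternating.hasMaxB {x : InfWord} (hx : IsAlternating x) : HasMaxB (psiInf x) := by
  rintro n w ⟨-, hw, v, hv, rfl⟩ w' ⟨v', hv', rfl⟩ hw'
  obtain ⟨u, rfl⟩ := head_of_prefix_psi hw'
  have hvx : x.take v.length = v := isPrefixOf_psi_iff.1 hw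
  rw [← hv'] at hv
  have h1 := count_psi_le_fib u
  have h2 := hx.count_psi_take u.length
  rw [hv, List.length_cons] at hvx
  rw [hvx] at h2
  omega

/-! ### The two directive words -/

theorem abOmega_eq : abOmega = [Letter.a, Letter.b] ++ₛ abOmega :=
  Stream'.cycle_eq _ _

theorem get_abOmega (n : ℕ) : abOmega.get n = blockLetter n := by
  induction n using Nat.twoStepInduction with
  | zero => rw [abOmega_eq]; rfl
  | one => rw [abOmega_eq]; rfl
  | more n ih _ => rw [abOmega_eq]; exact ih

theorem get_abb_abOmega (n : ℕ) :
    ([Letter.a, Letter.b, Letter.b] ++ₛ abOmega).get (n + 3) = blockLetter n :=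
  get_abOmega n

theorem isAlternating_abOmega : IsAlternating abOmega where
  get_zero := get_abOmega 0
  get_one := get_abOmega 1
  get_succ_ne k _ := by
    rw [get_abOmega, get_abOmega]
    exact blockLetter_succ_ne k

theorem isAlternating_abb_abOmega :
    IsAlternating ([Letter.a, Letter.b, Letter.b] ++ₛ abOmega) where
  get_zero := rfl
  get_one := rfl
  get_succ_ne k hk := by
    obtain ⟨k, rfl⟩ := Nat.exists_eq_add_of_le' hk
    cases k with
    | zero => rw [get_abb_abOmega]; change Letter.a ≠ Letter.b; decide
    | succ k =>
      rw [show k + 1 + 2 + 1 = (k + 1) + 3 from rfl, show k + 1 + 2 = k + 3 from rfl,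
        get_abb_abOmega, get_abb_abOmega]
      exact blockLetter_succ_ne k

theorem eq_of_ne_of_ne {x y z : Letter} (h1 : x ≠ z) (h2 : y ≠ z) : x = y := by
  cases x <;> cases y <;> cases z <;> simp_all

theorem IsAlternating.ext {x y : InfWord} (hx : IsAlternating x) (hy : IsAlternating y)
    (h : x.get 2 = y.get 2) : x = y := by
  apply Stream'.ext
  intro n
  match n with
  | 0 => rw [hx.get_zero, hy.get_zero]
  | 1 => rw [hx.get_one, hy.get_one]
  | n + 2 =>
    induction n with
    | zero => exact h
    | succ n ih =>
      have h1 := hx.get_succ_ne (n + 2) (by omega)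
      have h2 := hy.get_succ_ne (n + 2) (by omega)
      rw [← ih] at h2
      exact eq_of_ne_of_ne h1 h2

theorem IsAlternating.eq_or_eq {x : InfWord} (hx : IsAlternating x) :
    x = abOmega ∨ x = [Letter.a, Letter.b, Letter.b] ++ₛ abOmega := by
  cases h : x.get 2
  · exact Or.inl (hx.ext isAlternating_abOmega (by rw [h, get_abOmega]; rfl))
  · exact Or.inr (hx.ext isAlternating_abb_abOmega (by rw [h]; rfl))

theorem isCharSturmian_fibWord : IsCharSturmian fibWord := by
  refine ⟨fun _ => 1, fun _ _ => one_pos, convergesTo_stdWord (fun _ _ => one_pos) ?_⟩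
  refine Eventually.of_forall fun n => ?_
  have h : ∀ n, (blockWord (fun _ => 1) n).length = n := by
    intro n
    induction n with
    | zero => rfl
    | succ n ih => rw [blockWord, List.length_append, ih, List.length_replicate]
  induction n with
  | zero => rfl
  | succ n ih =>
    rw [blockWord, List.replicate_one, isPrefixOf_append_singleton, h, get_abOmega]
    exact ⟨ih, rfl⟩

theorem isCharSturmian_gWord : IsCharSturmian gWord := by
  -- Index 1 is the first block of b, so the blocks spell ab²abab⋯.
  let c : ℕ → ℕ := fun n => if n = 1 then 2 else 1
  have hc : ∀ n, 1 ≤ n → 0 < c n := by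
    intro n _
    change 0 < if n = 1 then 2 else 1
    split_ifs <;> norm_num
  refine ⟨c, hc, convergesTo_stdWord hc ?_⟩
  have hc2 : ∀ n, c (n + 2) = 1 := fun n => if_neg (by omega)
  have h : ∀ n, (blockWord c (n + 2)).length = n + 3 := by
    intro n
    induction n with
    | zero => rfl
    | succ n ih => rw [blockWord, List.length_append, ih, List.length_replicate, hc2]
  have h' : ∀ n, IsPrefixOf (blockWord c (n + 2))
      ([Letter.a, Letter.b, Letter.b] ++ₛ abOmega) := by
    intro n
    induction n with
    | zero => rfl
    | succ n ih =>
      rw [blockWord, hc2, List.replicate_one, isPrefixOf_append_singleton, h, get_abb_abOmega]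
      exact ⟨ih, rfl⟩
  filter_upwards [eventually_ge_atTop 2] with n hn
  obtain ⟨m, rfl⟩ := Nat.exists_eq_add_of_le' hn
  exact h' m

theorem HasMaxB.isAlternating {x : InfWord} (h0 : x.get 0 = Letter.a)
    (hx : HasMaxB (psiInf x)) : IsAlternating x := by
  refine isAlternating_of_count h0 fun k => le_antisymm ?_ ?_
  · rw [take_succ_eq_cons h0]
    simpa using count_psi_le_fib (x.tail.take k)
  · have ha : ∀ v, [Letter.a] <+: psi (Letter.a :: v) := by
      intro v
      induction v using List.reverseRecOn with
      | nil => exact psi_concat_prefix [] Letter.a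
      | append_singleton v z ih =>
        exact ih.trans ((List.prefix_append _ _).trans (psi_concat_prefix (Letter.a :: v) z))
    -- The competitor is the Fibonacci central word of the same order, which attains the upper
    -- bound.
    have h := hx (k + 1) (psi (x.take (k + 1)))
      ⟨psi_palindrome _, isPrefixOf_psiInf_take _ _, _, Stream'.length_take _ _, rfl⟩
      (psi (abOmega.take (k + 1))) ⟨_, Stream'.length_take _ _, rfl⟩
      (by rw [take_succ_eq_cons (get_abOmega 0)]; exact ha _)
    have h2 := isAlternating_abOmega.count_psi_take k
    omega

end CharSturm

theorem theorem4p9 (s : CharSturm.InfWord) :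
    (CharSturm.IsCharSturmian s ∧ s.head = CharSturm.Letter.a ∧ CharSturm.HasMaxB s) ↔
      (s = CharSturm.fibWord ∨ s = CharSturm.gWord) := by
  constructor
  · rintro ⟨hs, hhead, hmax⟩
    obtain ⟨x, rfl⟩ := hs.exists_psiInf
    rw [CharSturm.head_psiInf] at hhead
    rcases (hmax.isAlternating hhead).eq_or_eq with rfl | rfl
    · exact Or.inl rfl
    · exact Or.inr rfl
  · rintro (rfl | rfl)
    · exact ⟨CharSturm.isCharSturmian_fibWord,
        (CharSturm.head_psiInf _).trans CharSturm.isAlternating_abOmega.get_zero,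
        CharSturm.isAlternating_abOmega.hasMaxB⟩
    · exact ⟨CharSturm.isCharSturmian_gWord,
        (CharSturm.head_psiInf _).trans CharSturm.isAlternating_abb_abOmega.get_zero,
        CharSturm.isAlternating_abb_abOmega.hasMaxB⟩
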